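/- Consider spin configurations $\sigma\in\{0,1\}^{\mathbb{Z}^2}$, with the pointwise partial order and the $\sigma$-algebra generated by the cylinder sets. Two sites of $\mathbb{Z}^2$ are called adjacent if their Euclidean distance is $1$, and $*$adjacent if it is $1$ or $\sqrt2$. A $0$cluster of $\sigma$ is a maximal connected (with respect to adjacency) set of sites on which $\sigma$ equals $0$; a $1*$cluster of $\sigma$ is a maximal connected (with respect to $*$adjacency) set of sites on which $\sigma$ equals $1$. Theorem. There exists no probability measure $\mu$ on $\{0,1\}^{\mathbb{Z}^2}$ satisfying all of the following conditions: (i) $\mu$ is positively associated, i.e. $\mu(A\cap B)\ge\mu(A)\mu(B)$ for all increasing events $A$ and $B$, where an event $A$ is increasing if $\xi\in A$ and $\eta\ge\xi$ (pointwise) imply $\eta\in A$; (ii) $\mu$-almost surely there exists exactly one infinite $0$cluster; (iii) $\mu$-almost surely there exists at most one infinite $1*$cluster; (iv) $\mu$ satisfies the bounded energy condition: for every $n\in\mathbb{N}$ there is a constant $c_n>0$ such that $\mu(\eta\text{ on }\Delta\mid\xi\text{ off }\Delta)\ge c_n$ for all $\Delta\subset\mathbb{Z}^2$ with $|\Delta|=n$,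 all $\eta\in\{0,1\}^\Delta$, and $\mu$-almost every $\xi\in\{0,1\}^{\mathbb{Z}^2\setminus\Delta}$; (v) there is a constant $c>0$ such that for every $x\in\mathbb{Z}^2$ the $\mu$-probability that $x$ belongs to an infinite $1*$cluster is at least $c$. -/

import Mathlib

open MeasureTheory

namespace SitePercolation

/-- The sites of the square lattice. -/
abbrev Site : Type := ℤ × ℤ

/-- Spin configurations on the square lattice. They carry Mathlib's product order (pointwise)
and product σ-algebra (generated by the cylinder sets). -/
abbrev Config : Type := Site → Fin 2

/-- The square of the Euclidean distance of two sites. -/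
def sqDist (x y : Site) : ℤ := (x.1 - y.1) ^ 2 + (x.2 - y.2) ^ 2

/-- Two sites are adjacent if their Euclidean distance is `1`. -/
def latticeGraph : SimpleGraph Site where
  Adj x y := sqDist x y = 1
  symm := ⟨fun x y h => by
    have e : sqDist y x = sqDist x y := by unfold sqDist; ring
    rw [e]; exact h⟩
  loopless := ⟨fun x h => by simp [sqDist] at h⟩

/-- Two sites are `*`adjacent if their Euclidean distance is `1` or `√2`. -/
def starGraph : SimpleGraph Site where
  Adj x y := sqDist x y = 1 ∨ sqDist x y = 2
  symm := ⟨fun x y h => by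
    have e : sqDist y x = sqDist x y := by unfold sqDist; ring
    rw [e]; exact h⟩
  loopless := ⟨fun x h => by simp [sqDist] at h⟩

/-- There is a self-avoiding path of `G` from `x` to `y` which is contained in `C` and on which
all spins of `σ` are equal to `s`. -/
def ConnectedIn (G : SimpleGraph Site) (s : Fin 2) (σ : Config) (C : Set Site) (x y : Site) :
    Prop :=
  ∃ p : G.Walk x y, p.IsPath ∧ ∀ z ∈ p.support, z ∈ C ∧ σ z = s

/-- `S` is a maximal `G`-connected set of sites with spin `s`. -/
structure IsCluster (G : SimpleGraph Site) (s : Fin 2) (σ : Config) (S : Set Site) : Prop where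
  spin : ∀ x ∈ S, σ x = s
  connected : ∀ x ∈ S, ∀ y ∈ S, ConnectedIn G s σ S x y
  maximal : ∀ z ∉ S, ∀ x ∈ S, ¬ ConnectedIn G s σ Set.univ z x

/-- `S` is an infinite `0`cluster of `σ`. -/
def IsInfiniteZeroCluster (σ : Config) (S : Set Site) : Prop :=
  IsCluster latticeGraph 0 σ S ∧ S.Infinite

/-- `S` is an infinite `1*`cluster of `σ`. -/
def IsInfiniteOneStarCluster (σ : Config) (S : Set Site) : Prop :=
  IsCluster starGraph 1 σ S ∧ S.Infinite

/-- Positive association; an event is increasing if it is an upper set in the pointwise order. -/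
def PositivelyAssociated (μ : Measure Config) : Prop :=
  ∀ A B : Set Config, MeasurableSet A → MeasurableSet B → IsUpperSet A → IsUpperSet B →
    μ A * μ B ≤ μ (A ∩ B)

/-- The σ-algebra generated by the spins off `Δ`. -/
abbrev sigmaOff (Δ : Finset Site) : MeasurableSpace Config :=
  MeasurableSpace.comap (fun (σ : Config) (x : {x : Site // x ∉ Δ}) => σ x) inferInstance

/-- The event that the configuration agrees with `η` on `Δ`. -/
def agreesOn (Δ : Finset Site) (η : Δ → Fin 2) : Set Config :=
  {σ | ∀ x : Δ, σ x = η x}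

/-- The bounded energy condition: the conditional probability of any pattern `η` on a set `Δ` of
`n` sites, given the spins off `Δ`, is a.s. at least a constant `c > 0` depending only on `n`. -/
def BoundedEnergy (μ : Measure Config) : Prop :=
  ∀ n : ℕ, ∃ c : ℝ, 0 < c ∧ ∀ Δ : Finset Site, Δ.card = n → ∀ η : Δ → Fin 2,
    ∀ᵐ ξ ∂μ, c ≤ (μ[(agreesOn Δ η).indicator (fun _ => (1 : ℝ)) | sigmaOff Δ]) ξ

end SitePercolation

/-!
The idea is to find three sites that lie in the infinite `1*`cluster with probability bounded
below, although `0`walks to infinity separate them with probability close to one.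

*Emptying a box.* Choose a box which meets the infinite `0`cluster with probability close to one,
and set all spins in it to `0`. The law `ν` of the new configuration is still positively
associated, since the modification is monotone, and by bounded energy it still has at most one
infinite `1*`cluster (`BoundedEnergy.ae_map_zeroOn`). Now the origin itself lies in an infinite
`0`cluster with probability close to one. Emptying the box can cut only finitely many sites off
the infinite `1*`cluster, so remote sites are still in an infinite `1*`cluster with probability at
least `c / 2` (`Escapes.zeroOn_or`, `exists_finiteClusterBeyond_lt`).

*Crossing parities.* Let `y₀, y₁, …` run once around a large square loop. A `0`walk from the origin
to infinity crosses the arc `y₀, …, yₖ` an even or odd number of times, so that by positive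
association the probability that no such walk is even, or the probability that none is odd, is
small. For `k = 0` all walks are even, for the full loop all are odd. Hence for some `k` there are
even walks for the arc to `yₖ` and odd walks for the arc to `yₖ₊₁`, each with probability close to
one. By positive association `y₀`, `yₖ` and `yₖ₊₁` all lie in infinite `1*`clusters with
probability at least `(c / 2) ^ 3`, which depends neither on the box nor on the loop, so that all
these events occur together with positive probability.

*Planarity.* They cannot: join `yₖ` to `y₀` by a walk in the only infinite `1*`cluster. Together
with the arc it forms a closed walk, which a `0`walk can cross only at the arc, and the parity of
the crossings of a closed walk with a walk from the origin to the outside is its winding parity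
around the origin, the same for all walks (`not_escapesVia_both_parities`). Crossing parities are
defined by formulas with values in `ZMod 2`, so that no planar topology is needed.
-/

namespace SitePercolation

/-! ### Boxes -/

/-- The square box of sites both of whose coordinates have absolute value at most `n`. -/
noncomputable def box (n : ℕ) : Finset Site := Finset.Icc (-(n : ℤ)) n ×ˢ Finset.Icc (-(n : ℤ)) n

lemma mem_box {n : ℕ} {z : Site} :
    z ∈ box n ↔ (-(n : ℤ) ≤ z.1 ∧ z.1 ≤ n) ∧ (-(n : ℤ) ≤ z.2 ∧ z.2 ≤ n) := by
  simp [box]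

lemma box_mono {m n : ℕ} (h : m ≤ n) : box m ⊆ box n := by
  intro z hz
  rw [mem_box] at hz ⊢
  omega

lemma exists_mem_box (z : Site) : ∃ n, z ∈ box n :=
  ⟨z.1.natAbs + z.2.natAbs, by rw [mem_box]; omega⟩

lemma exists_subset_box (s : Finset Site) : ∃ n, s ⊆ box n := by
  choose f hf using exists_mem_box
  exact ⟨s.sup f, fun z hz => box_mono (Finset.le_sup hz) (hf z)⟩

lemma latticeGraph_adj_iff {x y : Site} : latticeGraph.Adj x y ↔
    (x.1 = y.1 ∧ (y.2 = x.2 + 1 ∨ x.2 = y.2 + 1)) ∨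
      (x.2 = y.2 ∧ (y.1 = x.1 + 1 ∨ x.1 = y.1 + 1)) := by
  change sqDist x y = 1 ↔ _
  unfold sqDist
  constructor
  · intro h
    have h1 : -1 ≤ x.1 - y.1 := by nlinarith [sq_nonneg (x.2 - y.2)]
    have h2 : x.1 - y.1 ≤ 1 := by nlinarith [sq_nonneg (x.2 - y.2)]
    have h3 : -1 ≤ x.2 - y.2 := by nlinarith [sq_nonneg (x.1 - y.1)]
    have h4 : x.2 - y.2 ≤ 1 := by nlinarith [sq_nonneg (x.1 - y.1)]
    generalize ha : x.1 - y.1 = a at *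
    generalize hb : x.2 - y.2 = b at *
    interval_cases a <;> interval_cases b <;> simp at h <;> omega
  · rintro (⟨h, h' | h'⟩ | ⟨h, h' | h'⟩) <;> rw [h, h'] <;> ring

lemma starGraph_adj_bounds {x y : Site} (h : starGraph.Adj x y) :
    (-1 ≤ x.1 - y.1 ∧ x.1 - y.1 ≤ 1) ∧ (-1 ≤ x.2 - y.2 ∧ x.2 - y.2 ≤ 1) := by
  change sqDist x y = 1 ∨ sqDist x y = 2 at h
  unfold sqDist at h
  refine ⟨⟨?_, ?_⟩, ?_, ?_⟩ <;> rcases h with h | h <;>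
    nlinarith [sq_nonneg (x.2 - y.2), sq_nonneg (x.1 - y.1)]

/-- Boxes are connected. -/
lemma exists_walk_in_box {n : ℕ} (s : Site) (hs : s ∈ box n) :
    ∃ p : latticeGraph.Walk (0, 0) s, ∀ z ∈ p.support, z ∈ box n := by
  induction hk : s.1.natAbs + s.2.natAbs using Nat.strong_induction_on generalizing s with
  | _ k ih =>
  have step : ∀ s' : Site, s' ∈ box n → s'.1.natAbs + s'.2.natAbs < k →
      latticeGraph.Adj s' s →
      ∃ p : latticeGraph.Walk (0, 0) s, ∀ z ∈ p.support, z ∈ box n := by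
    intro s' hs' hlt hadj
    obtain ⟨p, hp⟩ := ih _ hlt s' hs' rfl
    refine ⟨p.concat hadj, fun z hz => ?_⟩
    rw [SimpleGraph.Walk.support_concat] at hz
    simp only [List.mem_append, List.mem_singleton] at hz
    rcases hz with hz | rfl
    · exact hp z hz
    · exact hs
  obtain ⟨a, b⟩ := s
  rw [mem_box] at hs
  simp only at hs hk step
  rcases lt_trichotomy a 0 with h | h | h
  · refine step (a + 1, b) (by rw [mem_box]; simp only; omega) (by simp only; omega) ?_
    rw [latticeGraph_adj_iff]; simp
  · rcases lt_trichotomy b 0 with h' | h' | h'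
    · refine step (a, b + 1) (by rw [mem_box]; simp only; omega) (by simp only; omega) ?_
      rw [latticeGraph_adj_iff]; simp
    · subst h h'
      exact ⟨.nil, by simp [mem_box]⟩
    · refine step (a, b - 1) (by rw [mem_box]; simp only; omega) (by simp only; omega) ?_
      rw [latticeGraph_adj_iff]; simp
  · refine step (a - 1, b) (by rw [mem_box]; simp only; omega) (by simp only; omega) ?_
    rw [latticeGraph_adj_iff]; simp

/-! ### Crossing parities of `*`walks and lattice walks -/

lemma zmod_two_add_self (a : ZMod 2) : a + a = 0 := CharTwo.add_self_eq_zero a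

/-- The parity of the number of crossings of the `*`step from `u` to `v`, translated by a small
vector pointing up and right, with the horizontal ray that starts at `z` and goes to the right.
The translation makes all crossings transversal: there is one exactly if the upper end of the
step lies on the ray and the lower end in the row below. -/
def rayStep (u v z : Site) : ZMod 2 :=
  if (u.2 = z.2 ∧ z.1 ≤ u.1 ∧ v.2 = z.2 - 1) ∨ (v.2 = z.2 ∧ z.1 ≤ v.1 ∧ u.2 = z.2 - 1)
  then 1 else 0

/-- The parity of the number of crossings of a `*`walk with the ray from `z` to the right. -/
def rayCross : ∀ {a b : Site}, starGraph.Walk a b → Site → ZMod 2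
  | _, _, .nil, _ => 0
  | a, _, .cons (v := v) _ p, z => rayStep a v z + rayCross p z

/-- The indicator of the event that the lattice step from `z` to `z'` is vertical and the site `w`,
translated by the same vector, lies to the right of it, at a height between those of its ends. -/
def leftStep (z z' w : Site) : ZMod 2 :=
  if z.1 = z'.1 ∧ w.2 = min z.2 z'.2 ∧ z.1 ≤ w.1 then 1 else 0

/-- The parity of the number of crossings of a lattice walk with the leftward ray from the
translated site `w`. -/
def leftCross : ∀ {s t : Site}, latticeGraph.Walk s t → Site → ZMod 2
  | _, _, .nil, _ => 0
  | s, _, .cons (v := v) _ p, w => leftStep s v w + leftCross p w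

/-- The parity of the number of crossings of a (translated) `*`walk `γ` with a lattice walk `R`.
It is written as a boundary term: `R`, the rays from its ends to the right and a segment far on
the right bound a region, of which `leftCross R` is the indicator. -/
def cross {a b s t : Site} (γ : starGraph.Walk a b) (R : latticeGraph.Walk s t) : ZMod 2 :=
  rayCross γ s + rayCross γ t + leftCross R a + leftCross R b

lemma rayCross_append {a b c : Site} (p : starGraph.Walk a b) (q : starGraph.Walk b c)
    (z : Site) : rayCross (p.append q) z = rayCross p z + rayCross q z := by
  induction p with
  | nil => simp [rayCross]
  | cons h p ih => simp [rayCross, ih, add_assoc]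

lemma cross_append {a b c s t : Site} (p : starGraph.Walk a b) (q : starGraph.Walk b c)
    (R : latticeGraph.Walk s t) : cross (p.append q) R = cross p R + cross q R := by
  simp only [cross, rayCross_append]
  linear_combination -zmod_two_add_self (leftCross R b)

/-- For a closed `*`walk the crossing parity only depends on the ends of the lattice walk. -/
lemma cross_closed {a s t : Site} (γ : starGraph.Walk a a) (R : latticeGraph.Walk s t) :
    cross γ R = rayCross γ s + rayCross γ t := by
  simp only [cross]
  linear_combination zmod_two_add_self (leftCross R a)

/-- A `*`step and a lattice step without common site do not cross. -/
lemma cross_step_step {u v z z' : Site} (h : starGraph.Adj u v) (h' : latticeGraph.Adj z z')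
    (h1 : u ≠ z) (h2 : u ≠ z') (h3 : v ≠ z) (h4 : v ≠ z') :
    rayStep u v z + rayStep u v z' + leftStep z z' u + leftStep z z' v = 0 := by
  have hs := starGraph_adj_bounds h
  rw [latticeGraph_adj_iff] at h'
  obtain ⟨u1, u2⟩ := u
  obtain ⟨v1, v2⟩ := v
  obtain ⟨z1, z2⟩ := z
  obtain ⟨w1, w2⟩ := z'
  simp only [ne_eq, Prod.mk.injEq] at *
  have two : (1 : ZMod 2) + 1 = 0 := rfl
  rcases (by omega : v2 = u2 ∨ v2 = u2 + 1 ∨ v2 = u2 - 1) with rfl | rfl | rfl <;>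
  rcases h' with ⟨rfl, rfl | rfl⟩ | ⟨rfl, rfl | rfl⟩ <;>
  simp only [rayStep, leftStep, true_and] <;>
  split_ifs <;> first | omega | simp [two]

lemma cross_step {u v s t : Site} (h : starGraph.Adj u v) (R : latticeGraph.Walk s t)
    (hu : u ∉ R.support) (hv : v ∉ R.support) :
    rayStep u v s + rayStep u v t + leftCross R u + leftCross R v = 0 := by
  induction R with
  | nil => simp [leftCross, zmod_two_add_self]
  | @cons s s' t hs R ih =>
    simp only [SimpleGraph.Walk.support_cons, List.mem_cons, not_or] at hu hv
    have h0 := R.start_mem_support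
    have := cross_step_step h hs hu.1 (fun e => hu.2 (e ▸ h0)) hv.1 (fun e => hv.2 (e ▸ h0))
    simp only [leftCross]
    linear_combination this + ih hu.2 hv.2 - zmod_two_add_self (rayStep u v s')

/-- A `*`walk and a lattice walk without common site have crossing parity zero. -/
lemma cross_eq_zero {a b s t : Site} (γ : starGraph.Walk a b) (R : latticeGraph.Walk s t)
    (h : ∀ z ∈ γ.support, z ∉ R.support) : cross γ R = 0 := by
  induction γ with
  | nil => simp [cross, rayCross, zmod_two_add_self]
  | @cons a a' b ha p ih =>
    simp only [SimpleGraph.Walk.support_cons, List.mem_cons, forall_eq_or_imp] at h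
    have h1 := cross_step ha R h.1 (h.2 _ p.start_mem_support)
    have h2 := ih h.2
    simp only [cross, rayCross] at h2 ⊢
    linear_combination h1 + h2 - zmod_two_add_self (leftCross R a')

/-- The winding parity of a closed `*`walk around a site outside of a box that contains the walk
is zero. -/
lemma rayCross_eq_zero_of_notMem_box {a : Site} (γ : starGraph.Walk a a) {M : ℕ}
    (hγ : ∀ z ∈ γ.support, z ∈ box M) {t : Site} (ht : t ∉ box M) : rayCross γ t = 0 := by
  have two : (1 : ZMod 2) + 1 = 0 := rfl
  rw [mem_box] at ht
  -- To the left of the box, each crossing changes the side of the line through `t` on which the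
  -- walk is; at the other sites outside of the box, the ray does not meet the box.
  by_cases h1 : t.1 < -(M : ℤ)
  · have key : ∀ {a b : Site} (p : starGraph.Walk a b), (∀ z ∈ p.support, z ∈ box M) →
        rayCross p t = (if t.2 ≤ a.2 then 1 else 0) + (if t.2 ≤ b.2 then 1 else 0) := by
      intro a b p hp
      induction p with
      | nil => simp [rayCross, zmod_two_add_self]
      | @cons a a' b ha p ih =>
        simp only [SimpleGraph.Walk.support_cons, List.mem_cons, forall_eq_or_imp] at hp
        have e1 := mem_box.1 hp.1
        have e2 := mem_box.1 (hp.2 _ p.start_mem_support)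
        have hs := starGraph_adj_bounds ha
        have : rayStep a a' t
            = (if t.2 ≤ a.2 then 1 else 0) + (if t.2 ≤ a'.2 then 1 else 0) := by
          simp only [rayStep]
          split_ifs <;> first | omega | simp [two]
        rw [rayCross, ih hp.2, this]
        linear_combination zmod_two_add_self (if t.2 ≤ a'.2 then (1 : ZMod 2) else 0)
    rw [key γ hγ, zmod_two_add_self]
  · have key : ∀ {a b : Site} (p : starGraph.Walk a b), (∀ z ∈ p.support, z ∈ box M) →
        rayCross p t = 0 := by
      intro a b p hp
      induction p with
      | nil => simp [rayCross]
      | @cons a a' b ha p ih =>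
        simp only [SimpleGraph.Walk.support_cons, List.mem_cons, forall_eq_or_imp] at hp
        have e1 := mem_box.1 hp.1
        have e2 := mem_box.1 (hp.2 _ p.start_mem_support)
        rw [rayCross, ih hp.2, rayStep, if_neg (by omega), add_zero]
    exact key γ hγ

/-! ### A square loop around the origin -/

/-- The sites of the boundary of the box of size `L`, in counterclockwise order and starting from
the lower right corner, to which the loop returns at time `8 * L`. -/
def loop (L i : ℕ) : Site :=
  if i ≤ 2 * L then (L, -L + i)
  else if i ≤ 4 * L then (3 * L - i, L)
  else if i ≤ 6 * L then (-L, 5 * L - i)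
  else (-(7 * L) + i, -L)

lemma loop_adj (L i : ℕ) : starGraph.Adj (loop L i) (loop L (i + 1)) := by
  have : latticeGraph.Adj (loop L i) (loop L (i + 1)) := by
    rw [latticeGraph_adj_iff]
    unfold loop
    split_ifs <;> push_cast <;> omega
  exact Or.inl this

lemma loop_closed (L : ℕ) : loop L (8 * L) = loop L 0 := by
  unfold loop
  split_ifs <;> simp <;> omega

lemma loop_notMem_box (m i : ℕ) : loop (m + 1) i ∉ box m := by
  rw [mem_box]
  unfold loop
  split_ifs <;> push_cast <;> omega

/-- The initial segment of length `k` of the loop. -/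
def arc (L : ℕ) : ∀ k : ℕ, starGraph.Walk (loop L 0) (loop L k)
  | 0 => .nil
  | k + 1 => (arc L k).append (.cons (loop_adj L k) .nil)

lemma rayCross_arc (L k : ℕ) (z : Site) :
    rayCross (arc L k) z = ∑ i ∈ Finset.range k, rayStep (loop L i) (loop L (i + 1)) z := by
  induction k with
  | zero => simp [arc, rayCross]
  | succ k ih => simp [arc, rayCross_append, ih, Finset.sum_range_succ, rayCross]

/-- The loop winds once around the origin: its only step that crosses the ray from the origin to
the right is the one that ends at `(L, 0)`. -/
lemma rayCross_arc_origin {L : ℕ} (hL : 0 < L) : rayCross (arc L (8 * L)) (0, 0) = 1 := by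
  rw [rayCross_arc]
  have h : ∀ i ∈ Finset.range (8 * L),
      rayStep (loop L i) (loop L (i + 1)) (0, 0) = if i = L - 1 then 1 else 0 := by
    intro i hi
    rw [Finset.mem_range] at hi
    have hiff : (((loop L i).2 = 0 ∧ 0 ≤ (loop L i).1 ∧ (loop L (i + 1)).2 = 0 - 1) ∨
        ((loop L (i + 1)).2 = 0 ∧ 0 ≤ (loop L (i + 1)).1 ∧ (loop L i).2 = 0 - 1)) ↔
        i = L - 1 := by
      unfold loop
      split_ifs <;> push_cast <;> omega
    simp only [rayStep, hiff]
  rw [Finset.sum_congr rfl h, Finset.sum_ite_eq', if_pos (by rw [Finset.mem_range]; omega)]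

lemma rayCross_loop_eq_zero {L : ℕ} : ∃ M, ∀ t ∉ box M, rayCross (arc L (8 * L)) t = 0 := by
  obtain ⟨M, hM⟩ := exists_subset_box (arc L (8 * L)).support.toFinset
  refine ⟨M, fun t ht => ?_⟩
  have key : ∀ {b : Site} (p : starGraph.Walk (loop L 0) b), b = loop L 0 →
      (∀ z ∈ p.support, z ∈ box M) → rayCross p t = 0 := by
    rintro b p rfl hp
    exact rayCross_eq_zero_of_notMem_box p hp ht
  exact key _ (loop_closed L) fun z hz => hM (by simpa using hz)

lemma cross_arc_closed {L : ℕ} (hL : 0 < L) :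
    ∃ M, ∀ t ∉ box M, ∀ R : latticeGraph.Walk (0, 0) t, cross (arc L (8 * L)) R = 1 := by
  obtain ⟨M, hM⟩ := rayCross_loop_eq_zero (L := L)
  refine ⟨M, fun t ht R => ?_⟩
  rw [cross, hM t ht, rayCross_arc_origin hL, loop_closed]
  linear_combination zmod_two_add_self (leftCross R (loop L 0))


/-! ### Escaping walks and infinite clusters -/

/-- For every box there is a `G`-walk from `x` to a site outside of it that has the property `Q`
and on which all spins are equal to `s`. For trivial `Q` this says that the cluster of `x` is
infinite; unlike the clusters themselves, it is manifestly measurable. -/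
def EscapesVia (G : SimpleGraph Site) (s : Fin 2) (x : Site) (Q : ∀ t, G.Walk x t → Prop)
    (σ : Config) : Prop :=
  ∀ M : ℕ, ∃ t, ∃ p : G.Walk x t, (t ∉ box M ∧ Q t p) ∧ ∀ z ∈ p.support, σ z = s

/-- There are `G`-walks with constant spin `s` from `x` to the outside of every box. -/
def Escapes (G : SimpleGraph Site) (s : Fin 2) (x : Site) (σ : Config) : Prop :=
  EscapesVia G s x (fun _ _ => True) σ

lemma measurableSet_existsWalk (G : SimpleGraph Site) (s : Fin 2) (x : Site)
    (Q : ∀ t, G.Walk x t → Prop) :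
    MeasurableSet {σ : Config | ∃ t, ∃ p : G.Walk x t, Q t p ∧ ∀ z ∈ p.support, σ z = s} := by
  have : {σ : Config | ∃ t, ∃ p : G.Walk x t, Q t p ∧ ∀ z ∈ p.support, σ z = s}
      = ⋃ l ∈ {l : List Site | ∃ t, ∃ p : G.Walk x t, Q t p ∧ p.support = l},
          ⋂ z ∈ {z | z ∈ l}, {σ : Config | σ z = s} := by
    ext σ
    simp only [Set.mem_ofPred_eq, Set.mem_iUnion, Set.mem_iInter, exists_prop]
    constructor
    · rintro ⟨t, p, hQ, h⟩
      exact ⟨_, ⟨t, p, hQ, rfl⟩, h⟩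
    · rintro ⟨_, ⟨t, p, hQ, rfl⟩, h⟩
      exact ⟨t, p, hQ, h⟩
  rw [this]
  refine MeasurableSet.biUnion (Set.to_countable _) fun l _ =>
    MeasurableSet.biInter (Set.to_countable _) fun z _ => ?_
  exact measurableSet_eq_fun (measurable_pi_apply z) measurable_const

lemma measurableSet_escapesVia (G : SimpleGraph Site) (s : Fin 2) (x : Site)
    (Q : ∀ t, G.Walk x t → Prop) : MeasurableSet {σ | EscapesVia G s x Q σ} := by
  simp only [EscapesVia, Set.ofPred_forall]
  exact MeasurableSet.iInter fun M => measurableSet_existsWalk G s x _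

lemma measurableSet_escapes (G : SimpleGraph Site) (s : Fin 2) (x : Site) :
    MeasurableSet {σ | Escapes G s x σ} := measurableSet_escapesVia G s x _

lemma spin_eq_zero_of_le {a b : Fin 2} (h : a ≤ b) (hb : b = 0) : a = 0 := by omega

lemma spin_eq_one_of_le {a b : Fin 2} (h : a ≤ b) (ha : a = 1) : b = 1 := by omega

lemma EscapesVia.zero_of_le {G : SimpleGraph Site} {x : Site} {Q : ∀ t, G.Walk x t → Prop}
    {σ τ : Config} (h : EscapesVia G 0 x Q τ) (hle : σ ≤ τ) : EscapesVia G 0 x Q σ := fun M =>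
  let ⟨t, p, hQ, hp⟩ := h M
  ⟨t, p, hQ, fun z hz => spin_eq_zero_of_le (hle z) (hp z hz)⟩

lemma EscapesVia.one_of_le {G : SimpleGraph Site} {x : Site} {Q : ∀ t, G.Walk x t → Prop}
    {σ τ : Config} (h : EscapesVia G 1 x Q σ) (hle : σ ≤ τ) : EscapesVia G 1 x Q τ := fun M =>
  let ⟨t, p, hQ, hp⟩ := h M
  ⟨t, p, hQ, fun z hz => spin_eq_one_of_le (hle z) (hp z hz)⟩

lemma Escapes.spin {G : SimpleGraph Site} {s : Fin 2} {x : Site} {σ : Config}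
    (h : Escapes G s x σ) : σ x = s :=
  let ⟨_, p, _, hp⟩ := h 0
  hp x p.start_mem_support

lemma Escapes.of_walk {G : SimpleGraph Site} {s : Fin 2} {x y : Site} {σ : Config}
    (h : Escapes G s y σ) (q : G.Walk x y) (hq : ∀ z ∈ q.support, σ z = s) :
    Escapes G s x σ := by
  intro M
  obtain ⟨t, p, hQ, hp⟩ := h M
  refine ⟨t, q.append p, hQ, fun z hz => ?_⟩
  rcases SimpleGraph.Walk.mem_support_append_iff _ _ |>.1 hz with hz | hz
  exacts [hq z hz, hp z hz]

lemma IsCluster.escapes {G : SimpleGraph Site} {s : Fin 2} {σ : Config} {S : Set Site}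
    (hS : IsCluster G s σ S) (hinf : S.Infinite) {x : Site} (hx : x ∈ S) : Escapes G s x σ := by
  intro M
  obtain ⟨t, ht, htM⟩ := hinf.exists_notMem_finset (box M)
  obtain ⟨p, -, hp⟩ := hS.connected x hx t ht
  exact ⟨t, p, ⟨htM, trivial⟩, fun z hz => (hp z hz).2⟩

lemma ConnectedIn.of_walk {G : SimpleGraph Site} {s : Fin 2} {σ : Config} {C : Set Site}
    {x y : Site} (p : G.Walk x y) (hp : ∀ z ∈ p.support, z ∈ C ∧ σ z = s) :
    ConnectedIn G s σ C x y := by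
  classical
  exact ⟨p.bypass, p.bypass_isPath, fun z hz => hp z (p.support_bypass_subset_support hz)⟩

/-- A site from which there are walks to infinity lies in an infinite cluster. -/
lemma Escapes.exists_cluster {G : SimpleGraph Site} {s : Fin 2} {x : Site} {σ : Config}
    (h : Escapes G s x σ) : ∃ S, (IsCluster G s σ S ∧ S.Infinite) ∧ x ∈ S := by
  classical
  let S : Set Site := {y | ∃ p : G.Walk x y, ∀ z ∈ p.support, σ z = s}
  have hsub : ∀ {y : Site} (p : G.Walk x y), (∀ z ∈ p.support, σ z = s) →
      ∀ z ∈ p.support, z ∈ S := fun p hp z hz =>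
    ⟨p.takeUntil z hz, fun w hw => hp w (p.support_takeUntil_subset_support hz hw)⟩
  refine ⟨S, ⟨⟨fun y ⟨p, hp⟩ => hp y p.end_mem_support, ?_, ?_⟩, ?_⟩, .nil, by simp [h.spin]⟩
  · rintro y ⟨p, hp⟩ y' ⟨p', hp'⟩
    refine ConnectedIn.of_walk (p.reverse.append p') fun z hz => ?_
    rcases SimpleGraph.Walk.mem_support_append_iff _ _ |>.1 hz with hz | hz
    · rw [SimpleGraph.Walk.support_reverse, List.mem_reverse] at hz
      exact ⟨hsub p hp z hz, hp z hz⟩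
    · exact ⟨hsub p' hp' z hz, hp' z hz⟩
  · rintro z hz y ⟨p, hp⟩ ⟨q, -, hq⟩
    refine hz ⟨p.append q.reverse, fun w hw => ?_⟩
    rcases SimpleGraph.Walk.mem_support_append_iff _ _ |>.1 hw with hw | hw
    · exact hp w hw
    · rw [SimpleGraph.Walk.support_reverse, List.mem_reverse] at hw
      exact (hq w hw).2
  · intro hfin
    obtain ⟨M, hM⟩ := exists_subset_box hfin.toFinset
    obtain ⟨t, p, ⟨ht, -⟩, hp⟩ := h M
    exact ht (hM (hfin.mem_toFinset.2 ⟨p, hp⟩))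

/-- If there is at most one infinite `1*`cluster, escaping sites are connected. -/
lemma exists_star_walk {σ : Config}
    (huniq : ∀ S T : Set Site, IsInfiniteOneStarCluster σ S → IsInfiniteOneStarCluster σ T → S = T)
    {x y : Site} (hx : Escapes starGraph 1 x σ) (hy : Escapes starGraph 1 y σ) :
    ∃ p : starGraph.Walk x y, ∀ z ∈ p.support, σ z = 1 := by
  obtain ⟨S, hS, hxS⟩ := hx.exists_cluster
  obtain ⟨T, hT, hyT⟩ := hy.exists_cluster
  obtain rfl := huniq S T hS hT
  obtain ⟨p, -, hp⟩ := hS.1.connected x hxS y hyT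
  exact ⟨p, fun z hz => (hp z hz).2⟩

/-! ### The planar obstruction -/

/-- The walks from the origin whose crossing parity with the arc of length `k` is `b`. -/
def HasParity (L k : ℕ) (b : ZMod 2) (t : Site) (R : latticeGraph.Walk (0, 0) t) : Prop :=
  cross (arc L k) R = b

/-- For adjacent sites `y` and `y'` of the loop, suppose that `x`, `y` and `y'` all lie in the only
infinite `1*`cluster. An arc of the loop from `x` to `y` and a `1*`walk back to `x` form a closed
`*`walk, and a `0`walk from the origin to a remote site crosses only the arc. Hence the crossing
parity with the arc is the winding parity of the closed walk around the origin, which is the same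
for all such `0`walks. Replacing `y` by `y'` does not change the crossing parity. -/
lemma not_escapesVia_both_parities {σ : Config} {L k : ℕ}
    (huniq : ∀ S T : Set Site, IsInfiniteOneStarCluster σ S → IsInfiniteOneStarCluster σ T → S = T)
    (hx : Escapes starGraph 1 (loop L 0) σ) (hy : Escapes starGraph 1 (loop L k) σ)
    (hy' : Escapes starGraph 1 (loop L (k + 1)) σ)
    (h0 : EscapesVia latticeGraph 0 (0, 0) (HasParity L k 0) σ)
    (h1 : EscapesVia latticeGraph 0 (0, 0) (HasParity L (k + 1) 1) σ) : False := by
  obtain ⟨P, hP⟩ := exists_star_walk huniq hy hx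
  obtain ⟨M, hM⟩ := exists_subset_box ((arc L k).append P).support.toFinset
  obtain ⟨t, R, ⟨ht, hR⟩, hR0⟩ := h0 M
  obtain ⟨t', R', ⟨ht', hR'⟩, hR0'⟩ := h1 M
  have key : ∀ {t : Site} (R : latticeGraph.Walk (0, 0) t), t ∉ box M →
      (∀ z ∈ R.support, σ z = 0) →
      cross (arc L k) R = rayCross ((arc L k).append P) (0, 0) := by
    intro t R ht hR
    have e1 := cross_closed ((arc L k).append P) R
    rw [rayCross_eq_zero_of_notMem_box _ (fun z hz => hM (by simpa using hz)) ht,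
      cross_append, cross_eq_zero P R fun z hz hz' =>
        absurd ((hP z hz).symm.trans (hR z hz')) (by decide)] at e1
    simpa using e1
  have e0 := key R ht hR0
  have e1 := key R' ht' hR0'
  simp only [HasParity] at hR hR'
  rw [arc, cross_append, cross_eq_zero (.cons (loop_adj L k) .nil) R', add_zero, e1, ← e0,
    hR] at hR'
  · exact absurd hR' (by decide)
  · intro z hz hz'
    simp only [SimpleGraph.Walk.support_cons, SimpleGraph.Walk.support_nil, List.mem_cons,
      List.not_mem_nil, or_false] at hz
    have : σ z = 1 := by
      rcases hz with rfl | rfl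
      exacts [hy.spin, hy'.spin]
    exact absurd (this.symm.trans (hR0' z hz')) (by decide)

/-- A walk of one of the two parities escapes if any walk does. -/
lemma Escapes.parity {σ : Config} (L k : ℕ) (h : Escapes latticeGraph 0 (0, 0) σ) :
    EscapesVia latticeGraph 0 (0, 0) (HasParity L k 0) σ ∨
      EscapesVia latticeGraph 0 (0, 0) (HasParity L k 1) σ := by
  by_contra! hcon
  simp only [EscapesVia, not_forall] at hcon
  obtain ⟨⟨M, hM⟩, M', hM'⟩ := hcon
  obtain ⟨t, R, ⟨ht, -⟩, hR⟩ := h (max M M')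
  have hcase : ∀ b : ZMod 2, b = 0 ∨ b = 1 := by decide
  rcases hcase (cross (arc L k) R) with hb | hb
  · exact hM ⟨t, R, ⟨fun h' => ht (box_mono (le_max_left _ _) h'), hb⟩, hR⟩
  · exact hM' ⟨t, R, ⟨fun h' => ht (box_mono (le_max_right _ _) h'), hb⟩, hR⟩

lemma not_escapesVia_parity_start {σ : Config} (L : ℕ) :
    ¬ EscapesVia latticeGraph 0 (0, 0) (HasParity L 0 1) σ := by
  intro h
  obtain ⟨t, R, ⟨-, hR⟩, -⟩ := h 0
  rw [HasParity, arc, cross_closed] at hR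
  simp only [rayCross, add_zero] at hR
  exact absurd hR (by decide)

lemma not_escapesVia_parity_end {σ : Config} {L : ℕ} (hL : 0 < L) :
    ¬ EscapesVia latticeGraph 0 (0, 0) (HasParity L (8 * L) 0) σ := by
  intro h
  obtain ⟨M, hM⟩ := cross_arc_closed hL
  obtain ⟨t, R, ⟨ht, hR⟩, -⟩ := h M
  rw [HasParity, hM t ht] at hR
  exact absurd hR (by decide)

/-! ### Emptying a finite set of sites -/

/-- The configuration obtained by setting all spins in `Λ` to zero. -/
def zeroOn (Λ : Finset Site) (σ : Config) : Config := fun z => if z ∈ Λ then 0 else σ z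

lemma zeroOn_le (Λ : Finset Site) (σ : Config) : zeroOn Λ σ ≤ σ := by
  intro z
  simp only [zeroOn]
  split_ifs
  exacts [Fin.zero_le _, le_rfl]

lemma zeroOn_mono (Λ : Finset Site) : Monotone (zeroOn Λ) := by
  intro σ τ h z
  simp only [zeroOn]
  split_ifs
  exacts [le_rfl, h z]

lemma measurable_zeroOn_sigmaOff (Λ : Finset Site) : Measurable[sigmaOff Λ] (zeroOn Λ) := by
  let g : ({x : Site // x ∉ Λ} → Fin 2) → Config :=
    fun ξ z => if h : z ∈ Λ then 0 else ξ ⟨z, h⟩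
  have hg : Measurable g := by
    refine measurable_pi_lambda _ fun z => ?_
    by_cases h : z ∈ Λ
    · simp only [g, h, dite_true]; exact measurable_const
    · simp only [g, h, dite_false]; exact measurable_pi_apply _
  have : zeroOn Λ = g ∘ fun (σ : Config) (x : {x : Site // x ∉ Λ}) => σ x := by
    ext σ z
    by_cases h : z ∈ Λ <;> simp [zeroOn, g, h]
  rw [this]
  exact hg.comp (comap_measurable _)

lemma sigmaOff_le (Λ : Finset Site) : sigmaOff Λ ≤ MeasurableSpace.pi := by
  refine Measurable.comap_le ?_
  exact measurable_pi_lambda _ fun z => measurable_pi_apply _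

lemma measurable_zeroOn (Λ : Finset Site) : Measurable (zeroOn Λ) :=
  (measurable_zeroOn_sigmaOff Λ).mono (sigmaOff_le Λ) le_rfl

lemma measurableSet_agreesOn (Λ : Finset Site) (η : Λ → Fin 2) :
    MeasurableSet (agreesOn Λ η) := by
  simp only [agreesOn, Set.ofPred_forall]
  exact MeasurableSet.iInter fun z => measurable_pi_apply (z : Site) (measurableSet_singleton _)

/-- Under bounded energy, emptying a finite set of sites preserves almost sure properties: given
the spins off `Λ`, the pattern `0` on `Λ` has conditional probability bounded below. -/
lemma BoundedEnergy.ae_map_zeroOn {μ : Measure Config} [IsProbabilityMeasure μ]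
    (hμ : BoundedEnergy μ) (Λ : Finset Site) {p : Config → Prop} (hp : ∀ᵐ σ ∂μ, p σ) :
    ∀ᵐ σ ∂(μ.map (zeroOn Λ)), p σ := by
  obtain ⟨c, hc, h⟩ := hμ Λ.card
  replace h := h Λ rfl fun _ => 0
  set N := toMeasurable μ {σ | ¬ p σ} with hN
  have hN0 : μ N = 0 := by rw [hN, measure_toMeasurable]; exact hp
  have hNm : MeasurableSet N := measurableSet_toMeasurable _ _
  have hBm : MeasurableSet[sigmaOff Λ] (zeroOn Λ ⁻¹' N) := measurable_zeroOn_sigmaOff Λ hNm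
  have hA := measurableSet_agreesOn Λ fun _ => 0
  have hsub : zeroOn Λ ⁻¹' N ∩ agreesOn Λ (fun _ => 0) ⊆ N := by
    rintro σ ⟨hσ, hσ0⟩
    have : zeroOn Λ σ = σ := by
      ext z
      by_cases hz : z ∈ Λ
      · simp [zeroOn, hz, hσ0 ⟨z, hz⟩]
      · simp [zeroOn, hz]
    rwa [Set.mem_preimage, this] at hσ
  have hint : Integrable ((agreesOn Λ (fun _ => 0)).indicator fun _ => (1 : ℝ)) μ :=
    (integrable_const 1).indicator hA
  have e1 : ∫ σ in zeroOn Λ ⁻¹' N,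
      (μ[(agreesOn Λ (fun _ => 0)).indicator (fun _ => (1 : ℝ)) | sigmaOff Λ]) σ ∂μ = 0 := by
    rw [setIntegral_condExp (sigmaOff_le Λ) hint hBm, setIntegral_indicator hA,
      Measure.restrict_eq_zero.2 (measure_mono_null hsub hN0), integral_zero_measure]
  have e2 : ∫ _ in zeroOn Λ ⁻¹' N, c ∂μ ≤ 0 := by
    rw [← e1]
    exact setIntegral_mono_ae (integrable_const c).integrableOn integrable_condExp.integrableOn h
  rw [setIntegral_const, smul_eq_mul] at e2
  have e3 : μ.real (zeroOn Λ ⁻¹' N) = 0 :=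
    le_antisymm (nonpos_of_mul_nonpos_left e2 hc) measureReal_nonneg
  rw [measureReal_eq_zero_iff] at e3
  rw [← Measure.map_apply (measurable_zeroOn Λ) hNm] at e3
  exact measure_mono_null (subset_toMeasurable μ _) e3

/-- A `1*`walk from `x` either avoids `Λ = box n` or contains a `1*`walk off `Λ` from `x` to a
site next to `Λ`. -/
lemma exists_walk_to_box {n : ℕ} {σ : Config} {x t : Site} (p : starGraph.Walk x t)
    (hx : x ∉ box n) (hp : ∀ z ∈ p.support, σ z = 1) :
    (∀ z ∈ p.support, zeroOn (box n) σ z = 1) ∨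
      ∃ w ∈ box (n + 1), ∃ q : starGraph.Walk x w, ∀ z ∈ q.support, zeroOn (box n) σ z = 1 := by
  induction p with
  | nil => left; simpa [zeroOn, hx] using hp
  | @cons x x' t h p ih =>
    simp only [SimpleGraph.Walk.support_cons, List.mem_cons, forall_eq_or_imp] at hp ⊢
    have hx1 : zeroOn (box n) σ x = 1 := by simpa [zeroOn, hx] using hp.1
    by_cases hx' : x' ∈ box n
    · refine .inr ⟨x, ?_, .nil, by simpa using hx1⟩
      have := starGraph_adj_bounds h
      rw [mem_box] at hx' ⊢
      omega
    · rcases ih hx' hp.2 with h' | ⟨w, hw, q, hq⟩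
      · exact .inl ⟨hx1, h'⟩
      · refine .inr ⟨w, hw, .cons h q, ?_⟩
        simp only [SimpleGraph.Walk.support_cons, List.mem_cons, forall_eq_or_imp]
        exact ⟨hx1, hq⟩

/-- The event that some site of `box n` lies in a finite `1*`cluster that leaves `box m`. -/
def finiteClusterBeyond (n m : ℕ) : Set Config :=
  ⋃ w ∈ box n, {σ | Escapes starGraph 1 w σ}ᶜ ∩
    {σ | ∃ t, ∃ p : starGraph.Walk w t, t ∉ box m ∧ ∀ z ∈ p.support, σ z = 1}

lemma measurableSet_finiteClusterBeyond (n m : ℕ) :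
    MeasurableSet (finiteClusterBeyond n m) :=
  Finset.measurableSet_biUnion _ fun w _ =>
    (measurableSet_escapes _ _ w).compl.inter (measurableSet_existsWalk _ _ w _)

lemma finiteClusterBeyond_antitone (n : ℕ) : Antitone (finiteClusterBeyond n) := by
  intro m m' h
  refine Set.iUnion₂_mono fun w _ => Set.inter_subset_inter_right _ ?_
  rintro σ ⟨t, p, ht, hp⟩
  exact ⟨t, p, fun h' => ht (box_mono h h'), hp⟩

lemma iInter_finiteClusterBeyond (n : ℕ) : ⋂ m, finiteClusterBeyond n m = ∅ := by
  rw [Set.eq_empty_iff_forall_notMem]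
  intro σ hσ
  have hex : ∀ w : Site, ∃ M : ℕ, ¬ Escapes starGraph 1 w σ →
      ¬ ∃ t, ∃ p : starGraph.Walk w t, t ∉ box M ∧ ∀ z ∈ p.support, σ z = 1 := by
    intro w
    by_cases hw : Escapes starGraph 1 w σ
    · exact ⟨0, fun h => absurd hw h⟩
    · obtain ⟨M, hM⟩ := not_forall.1 hw
      exact ⟨M, fun _ ⟨t, p, ht, hp⟩ => hM ⟨t, p, ⟨ht, trivial⟩, hp⟩⟩
  choose f hf using hex
  have := Set.mem_iInter.1 hσ ((box n).sup f)
  simp only [finiteClusterBeyond, Set.mem_iUnion] at this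
  obtain ⟨w, hw, hne, t, p, ht, hp⟩ := this
  exact hf w hne ⟨t, p, fun h' => ht (box_mono (Finset.le_sup hw) h'), hp⟩

/-- A remote site of an infinite `1*`cluster stays in an infinite `1*`cluster after the box is
emptied, unless the emptying cuts off a finite cluster that extends that far. -/
lemma Escapes.zeroOn_or {n m : ℕ} (hnm : n ≤ m) {σ : Config} {x : Site} (hx : x ∉ box m)
    (h : Escapes starGraph 1 x σ) :
    Escapes starGraph 1 x (zeroOn (box n) σ) ∨
      zeroOn (box n) σ ∈ finiteClusterBeyond (n + 1) m := by
  by_cases hz : Escapes starGraph 1 x (zeroOn (box n) σ)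
  · exact .inl hz
  right
  obtain ⟨M, hM⟩ := not_forall.1 hz
  obtain ⟨t, p, ht, hp⟩ := h M
  rcases exists_walk_to_box p (fun h' => hx (box_mono hnm h')) hp with h' | ⟨w, hw, q, hq⟩
  · exact absurd ⟨t, p, ht, h'⟩ hM
  · refine Set.mem_iUnion₂.2
      ⟨w, hw, fun hesc => hz (Escapes.of_walk hesc q hq), x, q.reverse, hx, ?_⟩
    intro z hz
    rw [SimpleGraph.Walk.support_reverse, List.mem_reverse] at hz
    exact hq z hz

/-- After the box is emptied, the origin is connected to all infinite `0`clusters that meet the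
box. -/
lemma Escapes.zeroOn_origin {n : ℕ} {σ : Config} {s : Site} (hs : s ∈ box n)
    (h : Escapes latticeGraph 0 s σ) : Escapes latticeGraph 0 (0, 0) (zeroOn (box n) σ) := by
  obtain ⟨p, hp⟩ := exists_walk_in_box s hs
  exact Escapes.of_walk (EscapesVia.zero_of_le h (zeroOn_le _ _)) p fun z hz => by
    simp [zeroOn, hp z hz]


/-! ### Positive association -/

lemma PositivelyAssociated.real_mul_le {μ : Measure Config} [IsProbabilityMeasure μ]
    (h : PositivelyAssociated μ) {A B : Set Config} (hA : MeasurableSet A) (hB : MeasurableSet B)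
    (hA' : IsUpperSet A) (hB' : IsUpperSet B) : μ.real A * μ.real B ≤ μ.real (A ∩ B) := by
  rw [measureReal_def, measureReal_def, measureReal_def, ← ENNReal.toReal_mul]
  exact ENNReal.toReal_mono (measure_ne_top _ _) (h A B hA hB hA' hB')

lemma PositivelyAssociated.map {μ : Measure Config} (h : PositivelyAssociated μ)
    {f : Config → Config} (hf : Measurable f) (hf' : Monotone f) :
    PositivelyAssociated (μ.map f) := by
  intro A B hA hB hA' hB'
  rw [Measure.map_apply hf hA, Measure.map_apply hf hB, Measure.map_apply hf (hA.inter hB)]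
  exact h _ _ (hf hA) (hf hB) (fun _ _ hle ha => hA' (hf' hle) ha)
    fun _ _ hle ha => hB' (hf' hle) ha

/-- A positively associated law with at most one infinite `1*`cluster, for which remote sites lie
in infinite `1*`clusters with probability at least `c`, cannot have the origin in an infinite
`0`cluster with probability too close to one. For each `k` the walks to infinity from the origin
have one of two crossing parities with the arc of length `k`, and by positive association one of
the two parities occurs with probability close to one. As this parity changes from `0` to `1` when
the arc grows to the full loop, there are two consecutive arcs for which different parities
dominate, which is incompatible with three sites being in infinite `1*`clusters. -/
lemma PositivelyAssociated.false_of_coexistence {μ : Measure Config} [IsProbabilityMeasure μ]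
    (hpa : PositivelyAssociated μ)
    (huniq : ∀ᵐ σ ∂μ, ∀ S T : Set Site,
      IsInfiniteOneStarCluster σ S → IsInfiniteOneStarCluster σ T → S = T)
    {m : ℕ} {c δ : ℝ} (hc : 0 < c) (hδ : 0 < δ) (hδ1 : δ < 1) (hδc : 2 * δ < c * c * c)
    (hfar : ∀ x ∉ box m, c ≤ μ.real {σ | Escapes starGraph 1 x σ})
    (hzero : μ.real {σ | Escapes latticeGraph 0 (0, 0) σ}ᶜ ≤ δ * δ) : False := by
  set L := m + 1 with hL
  -- `F k b` is the increasing event that parity `b` does not occur for the arc of length `k`.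
  let F : ℕ → ZMod 2 → Set Config := fun k b =>
    {σ | EscapesVia latticeGraph 0 (0, 0) (HasParity L k b) σ}ᶜ
  have hFm : ∀ k b, MeasurableSet (F k b) := fun k b => (measurableSet_escapesVia _ _ _ _).compl
  have hFu : ∀ k b, IsUpperSet (F k b) := fun k b σ τ hle hσ hτ =>
    hσ (EscapesVia.zero_of_le hτ hle)
  have hprod : ∀ k, μ.real (F k 0) * μ.real (F k 1) ≤ δ * δ := fun k =>
    (hpa.real_mul_le (hFm k 0) (hFm k 1) (hFu k 0) (hFu k 1)).trans <|
      (measureReal_mono fun σ hσ h => (h.parity L k).elim hσ.1 hσ.2).trans hzero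
  have hstart : μ.real (F 0 0) ≤ δ := by
    have : F 0 1 = Set.univ := Set.eq_univ_of_forall fun σ => not_escapesVia_parity_start L
    have h := hprod 0
    rw [this, probReal_univ] at h
    nlinarith
  have hend : δ < μ.real (F (8 * L) 0) := by
    have : F (8 * L) 0 = Set.univ :=
      Set.eq_univ_of_forall fun σ => not_escapesVia_parity_end (by omega)
    rwa [this, probReal_univ]
  obtain ⟨k, hk, hk'⟩ : ∃ k, μ.real (F k 0) ≤ δ ∧ δ < μ.real (F (k + 1) 0) := by
    by_contra! hcon
    have : ∀ k, μ.real (F k 0) ≤ δ := fun k => Nat.rec hstart hcon k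
    exact absurd (this _) (not_le.2 hend)
  have hk1 : μ.real (F (k + 1) 1) ≤ δ := by
    have h := hprod (k + 1)
    by_contra! hcon
    nlinarith
  let I : Site → Set Config := fun x => {σ | Escapes starGraph 1 x σ}
  have hIm : ∀ x, MeasurableSet (I x) := measurableSet_escapes _ _
  have hIu : ∀ x, IsUpperSet (I x) := fun x σ τ hle h => EscapesVia.one_of_le h hle
  have hI : ∀ i, c ≤ μ.real (I (loop L i)) := fun i => hfar _ (loop_notMem_box m i)
  have h2 := hpa.real_mul_le (hIm (loop L 0)) (hIm (loop L k)) (hIu _) (hIu _)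
  have h3 := hpa.real_mul_le ((hIm (loop L 0)).inter (hIm (loop L k))) (hIm (loop L (k + 1)))
    ((hIu _).inter (hIu _)) (hIu _)
  have hge : c * c * c ≤ μ.real (I (loop L 0) ∩ I (loop L k) ∩ I (loop L (k + 1))) := by
    have e1 : c * c ≤ μ.real (I (loop L 0) ∩ I (loop L k)) :=
      (mul_le_mul (hI 0) (hI k) hc.le measureReal_nonneg).trans h2
    exact (mul_le_mul e1 (hI (k + 1)) hc.le measureReal_nonneg).trans h3
  have hle : μ.real (I (loop L 0) ∩ I (loop L k) ∩ I (loop L (k + 1))) ≤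
      μ.real (F k 0 ∪ F (k + 1) 1) := by
    refine ENNReal.toReal_mono (measure_ne_top _ _) (measure_mono_ae ?_)
    filter_upwards [huniq] with σ hσ hI
    by_contra hF
    obtain ⟨h0, h1⟩ := not_or.1 hF
    exact not_escapesVia_both_parities hσ hI.1.1 hI.1.2 hI.2 (not_not.1 h0) (not_not.1 h1)
  have := measureReal_union_le (μ := μ) (F k 0) (F (k + 1) 1)
  linarith

/-- Almost surely some infinite `0`cluster meets a large box. -/
lemma exists_box_meets_zeroCluster {μ : Measure Config} [IsProbabilityMeasure μ]
    (h : ∀ᵐ σ ∂μ, ∃ S : Set Site, IsInfiniteZeroCluster σ S) {ε : ℝ} (hε : 0 < ε) :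
    ∃ n, μ.real (⋂ s ∈ box n, {σ | Escapes latticeGraph 0 s σ}ᶜ) < ε := by
  let A : ℕ → Set Config := fun n => ⋂ s ∈ box n, {σ | Escapes latticeGraph 0 s σ}ᶜ
  have hA : ∀ n, MeasurableSet (A n) := fun n =>
    Finset.measurableSet_biInter _ fun s _ => (measurableSet_escapes _ _ _).compl
  have hlim := tendsto_measure_iInter_atTop (μ := μ) (fun n => (hA n).nullMeasurableSet)
    (fun a b hab => Set.biInter_subset_biInter_left (box_mono hab)) ⟨0, measure_ne_top _ _⟩
  have h0 : μ (⋂ n, A n) = 0 := by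
    refine measure_mono_null (fun σ hσ => ?_) h
    rintro ⟨S, hS, hinf⟩
    obtain ⟨s, hs⟩ := hinf.nonempty
    obtain ⟨n, hn⟩ := exists_mem_box s
    exact Set.mem_iInter₂.1 (Set.mem_iInter.1 hσ n) s hn (hS.escapes hinf hs)
  rw [h0] at hlim
  obtain ⟨n, hn⟩ := ((ENNReal.tendsto_toReal ENNReal.zero_ne_top).comp hlim).eventually
    (gt_mem_nhds (by simpa using hε)) |>.exists
  exact ⟨n, hn⟩

lemma exists_finiteClusterBeyond_lt (μ : Measure Config) [IsProbabilityMeasure μ] (n : ℕ) {ε : ℝ}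
    (hε : 0 < ε) : ∃ m ≥ n, μ.real (finiteClusterBeyond n m) < ε := by
  have hlim := tendsto_measure_iInter_atTop (μ := μ)
    (fun m => (measurableSet_finiteClusterBeyond n m).nullMeasurableSet)
    (finiteClusterBeyond_antitone n) ⟨0, measure_ne_top _ _⟩
  rw [iInter_finiteClusterBeyond, measure_empty] at hlim
  obtain ⟨m, hm, hmn⟩ := (((ENNReal.tendsto_toReal ENNReal.zero_ne_top).comp hlim).eventually
    (gt_mem_nhds (by simpa using hε)) |>.and (Filter.eventually_ge_atTop n)).exists
  exact ⟨m, hmn, hm⟩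

end SitePercolation

/-! ### Reduction to the law with an emptied box -/

theorem theorem1 :
    ¬ ∃ μ : MeasureTheory.Measure SitePercolation.Config,
      MeasureTheory.IsProbabilityMeasure μ ∧
      SitePercolation.PositivelyAssociated μ ∧
      (∀ᵐ σ ∂μ, ∃! S : Set SitePercolation.Site, SitePercolation.IsInfiniteZeroCluster σ S) ∧
      (∀ᵐ σ ∂μ, ∀ S T : Set SitePercolation.Site,
        SitePercolation.IsInfiniteOneStarCluster σ S →
        SitePercolation.IsInfiniteOneStarCluster σ T → S = T) ∧
      SitePercolation.BoundedEnergy μ ∧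
      (∃ c : ℝ, 0 < c ∧ ∀ x : SitePercolation.Site,
        c ≤ μ.real {σ | ∃ S : Set SitePercolation.Site,
          SitePercolation.IsInfiniteOneStarCluster σ S ∧ x ∈ S}) := by
  open SitePercolation in
  rintro ⟨μ, hμ, hpa, hzero, huniq, hbe, c, hc, hcx⟩
  -- `δ` is chosen such that `2 * δ < (c / 2) ^ 3` and `δ < 1`; note that `c ≤ 1`.
  have hc1 : c ≤ 1 := (hcx (0, 0)).trans measureReal_le_one
  set δ : ℝ := c / 2 * (c / 2) * (c / 2) / 4 with hδ
  have hc3 : 0 < c / 2 * (c / 2) * (c / 2) := by positivity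
  have hc3' : c / 2 * (c / 2) * (c / 2) ≤ 1 := by
    have h1 : c / 2 * (c / 2) ≤ 1 := by nlinarith
    nlinarith
  have hδ0 : 0 < δ := by positivity
  obtain ⟨n, hn⟩ := exists_box_meets_zeroCluster (hzero.mono fun σ h => h.exists)
    (mul_pos hδ0 hδ0)
  have hz := measurable_zeroOn (box n)
  have hprob : IsProbabilityMeasure (μ.map (zeroOn (box n))) :=
    Measure.isProbabilityMeasure_map hz.aemeasurable
  obtain ⟨m, hnm, hm⟩ :=
    exists_finiteClusterBeyond_lt (μ.map (zeroOn (box n))) (n + 1) (half_pos hc)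
  refine (hpa.map hz (zeroOn_mono _)).false_of_coexistence (hbe.ae_map_zeroOn _ huniq) (m := m)
    (half_pos hc) hδ0 (by linarith) (by linarith) (fun x hx => ?_) ?_
  · rw [map_measureReal_apply hz (measurableSet_finiteClusterBeyond _ _)] at hm
    rw [map_measureReal_apply hz (measurableSet_escapes _ _ _)]
    have h1 : μ.real {σ | ∃ S : Set Site, IsInfiniteOneStarCluster σ S ∧ x ∈ S} ≤
        μ.real (zeroOn (box n) ⁻¹' {σ | Escapes starGraph 1 x σ} ∪
          zeroOn (box n) ⁻¹' finiteClusterBeyond (n + 1) m) := by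
      refine measureReal_mono ?_
      rintro σ ⟨S, ⟨hS, hinf⟩, hxS⟩
      exact (hS.escapes hinf hxS).zeroOn_or (by omega) hx
    have h2 := measureReal_union_le (μ := μ) (zeroOn (box n) ⁻¹' {σ | Escapes starGraph 1 x σ})
      (zeroOn (box n) ⁻¹' finiteClusterBeyond (n + 1) m)
    linarith [hcx x]
  · rw [map_measureReal_apply hz (measurableSet_escapes _ _ _).compl]
    refine (measureReal_mono fun σ hσ => ?_).trans hn.le
    exact Set.mem_iInter₂.2 fun s hs h => hσ (h.zeroOn_origin hs)
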